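/- Let $Y_1,Y_2,\dots$ be i.i.d. standard exponential random variables and, independently of them, let $W_1,W_2,\dots$ be i.i.d. two-sided one-dimensional standard Brownian motions on $\mathbb R$ (with continuous paths). For $k\ge 1$ and $t\in\mathbb R$ put $$X_k=\log\frac1{Y_1+\dots+Y_k},\qquad Z(t)=\sup_{i\ge1}\Big(X_i+W_i(t)-\frac{|t|}2\Big),\qquad Z^{(k)}(t)=\max_{1\le i\le k}\Big(X_i+W_i(t)-\frac{|t|}2\Big),$$ so that $Z$ is the Brown–Resnick process associated with Brownian motion. Fix $b>0$, put $C_k=\inf_{t\in[-b,b]}\big(Z^{(k)}(t)+\frac{|t|}2\big)$, and let $\Phi$ be the standard normal distribution function. **Proposition.** Let $k\ge1$ and let $x(k)<c(k)<0$ be real numbers. Then $$\mathbb P\big(Z^{(k)}(t)\ne Z(t)\text{ for some }t\in[-b,b]\,\big|\,X_k\le x(k),\,C_k>c(k)\big)\le 4e^{-c(k)}\,\frac{b}{c(k)-x(k)}\,e^{b/2}\Big(1-\Phi\Big(\frac{c(k)-x(k)-b}{\sqrt b}\Big)\Big),\tag{1}$$ $$\mathbb P(C_k\le c(k))\le 1-\Big(1-\exp\big(-e^{-c(k)/2}\big)\Big)\Big(2\Phi\Big(-\frac{c(k)}{2\sqrt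 b}\Big)-1\Big)^2,\tag{2}$$ $$\mathbb P(X_k>x(k))\le\frac{e^{-(k-1)x(k)}}{(k-1)!}\Big(1-\exp\big(-e^{-x(k)}\big)\Big),\tag{3}$$ and the unconditional error probability $\mathbb P(Z^{(k)}(t)\ne Z(t)\text{ for some }t\in[-b,b])$ is at most the sum of the right-hand sides of (1), (2) and (3). (For $k=1$ the conditioning event in (1) is a null set; the conditional probability is then read as $0$.) Moreover, for $c(k)=-\log\log(\log(k)/2)$ and $x(k)=-\log(k)/2$ one has $x(k)<c(k)<0$ for all sufficiently large $k$, and each of the right-hand sides of (1), (2), (3) tends to $0$ as $k\to\infty$; hence $\mathbb P(Z^{(k)}(t)\ne Z(t)\text{ for some }t\in[-b,b])\to0$. Finally, the right-hand side of (1) grows like $b\,e^{b/2}$ in $b$: for fixed real numbers $x<c<0$, $$\lim_{b\to\infty}\frac{1}{b\,e^{b/2}}\cdot 4e^{-c}\,\frac{b}{c-x}\,e^{b/2}\Big(1-\Phi\Big(\frac{c-x-b}{\sqrt b}\Big)\Big)=\frac{4e^{-c}}{c-x}.$$ -/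

import Mathlib

open MeasureTheory ProbabilityTheory Filter Set
open scoped Topology NNReal ENNReal Nat

noncomputable section

namespace BrownResnick

/-- Two-sided one-dimensional standard Brownian motion on `ℝ`: the right and the left half are
independent standard Brownian motions (with almost surely continuous paths). -/
structure IsTwoSidedBrownian {Ω : Type*} [MeasurableSpace Ω] (W : ℝ → Ω → ℝ) (P : Measure Ω) :
    Prop where
  measurable : ∀ t, Measurable (W t)
  right : IsBrownianReal (fun (t : ℝ≥0) ω => W (t : ℝ) ω) P
  left : IsBrownianReal (fun (t : ℝ≥0) ω => W (-(t : ℝ)) ω) P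
  indep : IndepFun (fun ω (t : ℝ≥0) => W (t : ℝ) ω) (fun ω (t : ℝ≥0) => W (-(t : ℝ)) ω) P

/-- The random input of the simulation: i.i.d. standard exponential waiting times and,
independently of them, i.i.d. two-sided standard Brownian motions.
Both sequences are indexed from `0`, so `Y i`, `W i` are the `(i + 1)`-st waiting time and path. -/
structure IsInput {Ω : Type*} [MeasurableSpace Ω] (Y : ℕ → Ω → ℝ) (W : ℕ → ℝ → Ω → ℝ)
    (P : Measure Ω) : Prop where
  measurable_Y : ∀ i, Measurable (Y i)
  law_Y : ∀ i, HasLaw (Y i) (expMeasure 1) P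
  indep_Y : iIndepFun Y P
  brownian_W : ∀ i, IsTwoSidedBrownian (W i) P
  indep_W : iIndepFun (fun i ω t => W i t ω) P
  indep_Y_W : IndepFun (fun ω i => Y i ω) (fun ω i t => W i t ω) P

section Construction

variable {Ω : Type*} (Y : ℕ → Ω → ℝ) (W : ℕ → ℝ → Ω → ℝ)

/-- `X_k = log (1 / (Y_1 + ⋯ + Y_k))` for `k ≥ 1`, the `k`-th largest point of the Poisson point
process. -/
def point (k : ℕ) (ω : Ω) : ℝ := Real.log (1 / ∑ i ∈ Finset.range k, Y i ω)

/-- The `(i + 1)`-st term `X_{i+1} + W_{i+1}(t) - σ²(t) / 2`, where `σ²(t) = |t|` is the variance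
of Brownian motion at `t`. -/
def component (i : ℕ) (t : ℝ) (ω : Ω) : ℝ := point Y (i + 1) ω + W i t ω - |t| / 2

/-- The Brown-Resnick process `Z`, the pointwise supremum of all terms. It is taken in the extended
reals, so that no convention about unbounded families enters. -/
def Z (t : ℝ) (ω : Ω) : EReal := ⨆ i : ℕ, (component Y W i t ω : EReal)

/-- `Z^{(k)}`, the maximum of the first `k` terms (for `k ≥ 1`). -/
def Zk (k : ℕ) (t : ℝ) (ω : Ω) : ℝ := ⨆ i : Fin k, component Y W i t ω

/-- `C_k = inf_{t ∈ [-b,b]} (Z^{(k)}(t) + σ²(t) / 2)`. -/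
def Ck (b : ℝ) (k : ℕ) (ω : Ω) : ℝ := ⨅ t : Icc (-b) b, (Zk Y W k t ω + |(t : ℝ)| / 2)

/-- The event that `Z^{(k)}(t) ≠ Z(t)` for some `t ∈ [-b,b]`. -/
def errorEvent (b : ℝ) (k : ℕ) : Set Ω := {ω | ∃ t ∈ Icc (-b) b, (Zk Y W k t ω : EReal) ≠ Z Y W t ω}

end Construction

/-- The standard normal distribution function `Φ`. -/
def Phi (u : ℝ) : ℝ := cdf (gaussianReal 0 1) u

/-- The bound for the conditional error probability. -/
def condBound (b c x : ℝ) : ℝ :=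
  4 * Real.exp (-c) * (b / (c - x)) * Real.exp (b / 2) * (1 - Phi ((c - x - b) / √b))

/-- The bound for `P(C_k ≤ c)`. -/
def infBound (b c : ℝ) : ℝ :=
  1 - (1 - Real.exp (-Real.exp (-c / 2))) * (2 * Phi (-c / (2 * √b)) - 1) ^ 2

/-- The bound for `P(X_k > x)`. -/
def pointBound (k : ℕ) (x : ℝ) : ℝ :=
  Real.exp (-((k : ℝ) - 1) * x) / ((k - 1)! : ℕ) * (1 - Real.exp (-Real.exp (-x)))

/-- The choice `c(k) = -log log (log k / 2)`. -/
def cSeq (k : ℕ) : ℝ := -Real.log (Real.log (Real.log k / 2))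

/-- The choice `x(k) = -(log k) / 2`. -/
def xSeq (k : ℕ) : ℝ := -Real.log k / 2

end BrownResnick

end

namespace BrownResnick

/-! For (1), suppose `X_k ≤ x` and `C_k > c`. An error at `t` forces a later term to exceed
`Z^{(k)}(t)`, so after cancelling `|t|/2` some later point plus its path exceeds `c` at `t`. Since
`Y_1 + ⋯ + Y_k ≥ e^{-x}`, replacing this sum by `e^{-x}` only raises the later points. The resulting
events `exceed` involve only waiting times and paths after the `k`-th, hence are independent of the
conditioning event, and no conditional law is needed.

Lévy's maximal inequality on both half-lines bounds the probability of each such event by the mean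
of `g(e^{-x} + T)`, where `g(u) = 4 P(N(0,b) > c + log u)` and `T` is the sum of the later waiting
times involved. A unit-rate Poisson process has Lebesgue measure as renewal measure, so summing over
the later points gives at most `∫ g` over `(e^{-x}, ∞)`. The substitution `u = e^{y-c}`, Mills'
ratio and completion of the square turn this integral into the right-hand side of (1).

For (2), the first term alone keeps `C_k` above `c` when `X_1 > c/2` and `W_1 ≥ c/2` on the
interval; these events are independent, and the two halves of `W_1` give the square. For (3), `X_k >
x` means that a sum of `k` exponentials is below `e^{-x}`, which is estimated by induction on `k`.
The total error follows by a union bound. -/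

instance : IsProbabilityMeasure (expMeasure 1) := isProbabilityMeasure_expMeasure one_pos

/-! ### Exponential law and its renewal measure -/

theorem lintegral_expMeasure_one (g : ℝ → ℝ≥0∞) (hg : Measurable g) :
    ∫⁻ y, g y ∂(expMeasure 1) = ∫⁻ y in Ioi 0, ENNReal.ofReal (Real.exp (-y)) * g y := by
  have hm : Measurable (exponentialPDF 1) := by
    unfold exponentialPDF exponentialPDFReal
    exact (measurable_gammaPDFReal 1 1).ennreal_ofReal
  have h : expMeasure 1 = volume.withDensity (exponentialPDF 1) := rfl
  rw [h, lintegral_withDensity_eq_lintegral_mul _ hm hg,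
    ← setLIntegral_congr (Ioi_ae_eq_Ici (a := (0 : ℝ)) (μ := volume)).symm]
  rw [← lintegral_indicator measurableSet_Ici]
  refine lintegral_congr fun y => ?_
  by_cases hy : 0 ≤ y
  · simp [exponentialPDF_eq, hy]
  · simp [exponentialPDF_eq, hy]

theorem expMeasure_one_Iio {t : ℝ} (ht : 0 ≤ t) :
    expMeasure 1 (Iio t) = ENNReal.ofReal (1 - Real.exp (-t)) := by
  have h := cdf_expMeasure_eq one_pos t
  simp only [ht, if_true, one_mul] at h
  have hna : expMeasure 1 {t} = 0 := by
    have : expMeasure 1 ≪ volume := withDensity_absolutelyContinuous _ _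
    exact this (by simp)
  rw [measure_congr (Iio_ae_eq_Iic' hna), ← h, cdf_eq_real, ofReal_measureReal]

theorem ae_pos_expMeasure_one : ∀ᵐ y ∂(expMeasure 1), 0 < y := by
  rw [ae_iff]
  have h := cdf_expMeasure_eq one_pos 0
  simp only [le_refl, if_true, one_mul, neg_zero, Real.exp_zero, sub_self, cdf_eq_real] at h
  have h2 : {a : ℝ | ¬ 0 < a} = Iic 0 := by ext; simp
  rw [h2]
  exact (measureReal_eq_zero_iff).1 h

/-- The transition operator of the random walk with standard exponential steps. -/
noncomputable def expStep (f : ℝ → ℝ≥0∞) (s : ℝ) : ℝ≥0∞ := ∫⁻ y, f (s + y) ∂(expMeasure 1)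

theorem measurable_expStep {f : ℝ → ℝ≥0∞} (hf : Measurable f) : Measurable (expStep f) :=
  Measurable.lintegral_prod_right' (f := fun p : ℝ × ℝ => f (p.1 + p.2)) (by fun_prop)

/-- Lebesgue measure is the renewal measure of a Poisson process. -/
theorem expStep_add_setLIntegral {f : ℝ → ℝ≥0∞} (hf : Measurable f) (s : ℝ) :
    expStep (fun t => f t + ∫⁻ u in Ioi t, f u) s = ∫⁻ u in Ioi s, f u := by
  have hG : ∀ t, ∫⁻ u in Ioi t, f u = ∫⁻ u, (if t < u then f u else 0) := fun t => by
    rw [← lintegral_indicator measurableSet_Ioi]; rfl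
  have hJ : Measurable fun p : ℝ × ℝ => if s + p.1 < p.2 then f p.2 else 0 :=
    Measurable.ite (measurableSet_lt (by fun_prop) (by fun_prop)) (by fun_prop) measurable_const
  -- The first step lands at `u` with density `e^{-(u-s)}`; by Tonelli (`h2`) the integral term
  -- weights `u` by the probability `1 - e^{-(u-s)}` that the step falls short of `u`. The weights
  -- add up to `1`.
  have h1 : expStep f s = ∫⁻ u, (if s < u then ENNReal.ofReal (Real.exp (-(u - s))) * f u else 0) := by
    unfold expStep
    rw [lintegral_expMeasure_one _ (by fun_prop), ← lintegral_indicator measurableSet_Ioi,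
      ← lintegral_add_left_eq_self _ (-s)]
    refine lintegral_congr fun u => ?_
    by_cases hu : s < u
    · have : u ∈ Ioi s := hu
      simp [indicator, hu, sub_eq_neg_add]
    · simp [indicator, hu]
  have h2 : ∫⁻ y, (∫⁻ u in Ioi (s + y), f u) ∂(expMeasure 1)
      = ∫⁻ u, (if s < u then ENNReal.ofReal (1 - Real.exp (-(u - s))) * f u else 0) := by
    simp only [hG]
    rw [lintegral_lintegral_swap hJ.aemeasurable]
    refine lintegral_congr fun u => ?_
    have h3 : (fun y : ℝ => if s + y < u then f u else 0)
        = (Iio (u - s)).indicator (fun _ => f u) := by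
      ext y; simp [indicator, lt_sub_iff_add_lt']
    rw [h3, lintegral_indicator measurableSet_Iio, setLIntegral_const]
    split_ifs with hu
    · rw [expMeasure_one_Iio (by linarith), mul_comm]
    · have : expMeasure 1 (Iio (u - s)) = 0 := by
        refine measure_mono_null ?_ ((ae_iff).1 ae_pos_expMeasure_one)
        intro y hy
        simp only [mem_Iio, mem_ofPred_eq, not_lt] at *
        linarith
      rw [this, mul_zero]
  have h4 : expStep (fun t => f t + ∫⁻ u in Ioi t, f u) s
      = expStep f s + ∫⁻ y, (∫⁻ u in Ioi (s + y), f u) ∂(expMeasure 1) := by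
    unfold expStep
    exact lintegral_add_left (by fun_prop) _
  rw [h4, h1, h2, hG, ← lintegral_add_left]
  · refine lintegral_congr fun u => ?_
    split_ifs with hu
    · rw [← add_mul, ← ENNReal.ofReal_add (Real.exp_nonneg _)]
      · simp
      · have := Real.exp_le_one_iff.2 (show -(u - s) ≤ 0 by linarith); linarith
    · simp
  · exact Measurable.ite (measurableSet_lt (by fun_prop) (by fun_prop)) (by fun_prop)
      measurable_const

/-- With `G` the tail integral of `f`, the renewal identity reads `G = expStep (f + G)`. Iterating
it and dropping the nonnegative remainder gives the bound, with no integrability assumption. -/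
theorem sum_iterate_expStep_le {f : ℝ → ℝ≥0∞} (hf : Measurable f) (n : ℕ) (s : ℝ) :
    ∑ j ∈ Finset.range n, (expStep^[j + 1] f) s ≤ ∫⁻ u in Ioi s, f u := by
  have hm : ∀ j, Measurable (expStep^[j] f) := fun j => by
    induction j with
    | zero => exact hf
    | succ j ih => rw [Function.iterate_succ_apply']; exact measurable_expStep ih
  induction n generalizing s with
  | zero => simp
  | succ n ih =>
    rw [← expStep_add_setLIntegral hf, Finset.sum_range_succ']
    unfold expStep
    calc _ = ∫⁻ y, (f (s + y) + ∑ j ∈ Finset.range n, (expStep^[j + 1] f) (s + y))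
            ∂(expMeasure 1) := by
          rw [lintegral_add_left (by fun_prop), lintegral_finsetSum, add_comm]
          · congr 1
            refine Finset.sum_congr rfl fun j _ => ?_
            rw [Function.iterate_succ_apply']; rfl
          · exact fun j _ => (hm (j + 1)).comp (by fun_prop)
      _ ≤ _ := lintegral_mono fun y => add_le_add le_rfl (ih _)

/-! ### The walk of partial sums of exponentials -/

section Walk

variable {Ω : Type*} [MeasurableSpace Ω] {P : Measure Ω} {Y : ℕ → Ω → ℝ}

theorem lintegral_add_of_indepFun_exp {S X : Ω → ℝ} (hS : Measurable S) (hX : Measurable X)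
    (hlaw : HasLaw X (expMeasure 1) P) (hi : IndepFun S X P) [IsProbabilityMeasure P]
    {f : ℝ → ℝ≥0∞} (hf : Measurable f) :
    ∫⁻ ω, f (S ω + X ω) ∂P = ∫⁻ ω, expStep f (S ω) ∂P := by
  have h := (indepFun_iff_map_prod_eq_prod_map_map hS.aemeasurable hX.aemeasurable).1 hi
  calc _ = ∫⁻ p : ℝ × ℝ, f (p.1 + p.2) ∂(P.map fun ω => (S ω, X ω)) := by
        rw [lintegral_map (by fun_prop) (by fun_prop)]
    _ = ∫⁻ s, expStep f s ∂(P.map S) := by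
        rw [h, lintegral_prod _ (by fun_prop), hlaw.map_eq]; rfl
    _ = _ := lintegral_map (measurable_expStep hf) hS

variable [IsProbabilityMeasure P] (hm : ∀ i, Measurable (Y i))
  (hlaw : ∀ i, HasLaw (Y i) (expMeasure 1) P) (hi : iIndepFun Y P)

include hm hlaw hi in
theorem lintegral_walk (s : ℝ) (n : ℕ) {f : ℝ → ℝ≥0∞} (hf : Measurable f) :
    ∫⁻ ω, f (s + ∑ i ∈ Finset.range n, Y i ω) ∂P = (expStep^[n] f) s := by
  induction n generalizing f with
  | zero => simp
  | succ n ih =>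
    have h := hi.indepFun_sum_range_succ hm n
    have := lintegral_add_of_indepFun_exp (S := ∑ i ∈ Finset.range n, Y i) (X := Y n)
      (by fun_prop) (hm n) (hlaw n) h (f := fun t => f (s + t))
      (by fun_prop)
    simp_rw [Finset.sum_range_succ]
    simp only [Finset.sum_apply] at this
    rw [this, Function.iterate_succ_apply, ← ih (measurable_expStep hf)]
    simp [expStep, add_assoc]

-- Integrate out the last step `y`: since `e^{-y} (1 - e^{-(r-y)}) = e^{-y} - e^{-r} ≤ 1 - e^{-r}`,
-- the last factor survives the induction unchanged, and `(r-y)^k / k!` integrates to `r^{k+1} /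
-- (k+1)!`.
include hm hlaw hi in
theorem measure_walk_lt_le (k : ℕ) {r : ℝ} (hr : 0 ≤ r) :
    P {ω | ∑ i ∈ Finset.range (k + 1), Y i ω < r}
      ≤ ENNReal.ofReal (r ^ k / k ! * (1 - Real.exp (-r))) := by
  induction k generalizing r with
  | zero =>
    simp only [zero_add, Finset.range_one, Finset.sum_singleton, pow_zero, Nat.factorial_zero,
      Nat.cast_one, div_one, one_mul]
    rw [← expMeasure_one_Iio hr, ← (hlaw 0).map_eq, Measure.map_apply (hm 0) measurableSet_Iio]
    rfl
  | succ k ih =>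
    have hS : Measurable fun ω => ∑ i ∈ Finset.range (k + 1), Y i ω :=
      Finset.measurable_sum _ fun i _ => hm i
    have h := hi.indepFun_sum_range_succ hm (k + 1)
    have h' : IndepFun (Y (k + 1)) (fun ω => ∑ i ∈ Finset.range (k + 1), Y i ω) P := by
      convert h.symm using 1; ext; simp
    have h2 := (indepFun_iff_map_prod_eq_prod_map_map (hm (k + 1)).aemeasurable
      hS.aemeasurable).1 h'
    have hset : MeasurableSet {p : ℝ × ℝ | p.2 + p.1 < r} :=
      measurableSet_lt (by fun_prop) (by fun_prop)
    have h3 : P {ω | ∑ i ∈ Finset.range (k + 1 + 1), Y i ω < r}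
        = (P.map fun ω => (Y (k + 1) ω, ∑ i ∈ Finset.range (k + 1), Y i ω))
          {p : ℝ × ℝ | p.2 + p.1 < r} := by
      rw [Measure.map_apply ((hm _).prodMk hS) hset]
      simp [Finset.sum_range_succ _ (k + 1)]
    set C := 1 - Real.exp (-r)
    have hpos : ∀ᵐ ω ∂P, ∀ i, 0 < Y i ω := ae_all_iff.2 fun i =>
      ae_of_ae_map (hm i).aemeasurable ((hlaw i).map_eq.symm ▸ ae_pos_expMeasure_one)
    have hint : ∫⁻ y in Ioo 0 r, ENNReal.ofReal ((r - y) ^ k / k !)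
        = ENNReal.ofReal (r ^ (k + 1) / (k + 1)!) := by
      rw [← ofReal_integral_eq_lintegral_ofReal, ← integral_Ioc_eq_integral_Ioo,
        ← intervalIntegral.integral_of_le hr]
      · congr 1
        rw [intervalIntegral.integral_comp_sub_left (fun y => y ^ k / k !) r]
        simp [Nat.factorial_succ]
        field_simp
      · exact (Continuous.integrableOn_Icc (by fun_prop)).mono_set Ioo_subset_Icc_self
      · filter_upwards [self_mem_ae_restrict measurableSet_Ioo] with y hy
        have : 0 ≤ r - y := by linarith [hy.2]
        positivity
    rw [h3, h2, Measure.prod_apply hset, (hlaw _).map_eq,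
      lintegral_expMeasure_one _ (measurable_measure_prodMk_left hset),
      mul_comm, ENNReal.ofReal_mul (by
        have := Real.exp_le_one_iff.2 (show -r ≤ 0 by linarith); simp only [C]; linarith), ← hint,
      ← lintegral_const_mul _ (by fun_prop)]
    rw [← lintegral_indicator measurableSet_Ioi, ← lintegral_indicator measurableSet_Ioo]
    refine lintegral_mono fun y => ?_
    by_cases hy0 : 0 < y
    swap
    · simp [indicator, hy0]
    have hmap : (P.map fun ω => ∑ i ∈ Finset.range (k + 1), Y i ω)
        (Prod.mk y ⁻¹' {p : ℝ × ℝ | p.2 + p.1 < r})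
        = P {ω | ∑ i ∈ Finset.range (k + 1), Y i ω < r - y} := by
      rw [Measure.map_apply hS (measurable_prodMk_left hset)]
      simp [lt_sub_iff_add_lt]
    by_cases hyr : y < r
    · have h5 : 0 ≤ r - y := by linarith
      simp only [indicator, mem_Ioi, hy0, if_true, mem_Ioo, hyr, and_self, hmap]
      refine (mul_le_mul_right (ih h5) _).trans ?_
      rw [← ENNReal.ofReal_mul (Real.exp_nonneg _), ← ENNReal.ofReal_mul (by
        have := Real.exp_le_one_iff.2 (show -r ≤ 0 by linarith); simp only [C]; linarith)]
      refine ENNReal.ofReal_le_ofReal ?_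
      have h6 : Real.exp (-y) * Real.exp (-(r - y)) = Real.exp (-r) := by
        rw [← Real.exp_add]; congr 1; ring
      have h7 := Real.exp_le_one_iff.2 (show -y ≤ 0 by linarith)
      have h8 : 0 ≤ (r - y) ^ k / (k ! : ℝ) := by positivity
      calc _ = (Real.exp (-y) - Real.exp (-r)) * ((r - y) ^ k / k !) := by rw [← h6]; ring
        _ ≤ _ := by gcongr; simp only [C]; linarith
    · have h5 : P {ω | ∑ i ∈ Finset.range (k + 1), Y i ω < r - y} = 0 := by
        refine measure_mono_null ?_ (ae_iff.1 hpos)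
        intro ω hω hp
        simp only [mem_ofPred_eq] at hω hp
        have : 0 ≤ ∑ i ∈ Finset.range (k + 1), Y i ω := Finset.sum_nonneg fun i _ => (hp i).le
        linarith
      rw [← hmap] at h5
      simp only [indicator, h5, mul_zero, ite_self, zero_le]

end Walk

/-! ### Gaussian tails and the integral in (1) -/

theorem gaussianReal_Ioi (m : ℝ) {v : ℝ≥0} (hv : v ≠ 0) (u : ℝ) :
    gaussianReal m v (Ioi u) = ENNReal.ofReal (1 - Phi ((u - m) / √v)) := by
  have hs : 0 < √(v : ℝ) := Real.sqrt_pos.2 (by positivity)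
  have h0 : gaussianReal m v = (gaussianReal 0 1).map (fun z => √(v : ℝ) * z + m) := by
    have h1 := gaussianReal_map_const_mul (μ := 0) (v := 1) √(v : ℝ)
    have h2 := gaussianReal_map_add_const (μ := √(v : ℝ) * 0)
      (v := .mk (√(v : ℝ) ^ 2) (sq_nonneg _) * 1) m
    rw [← h1, Measure.map_map (by fun_prop) (by fun_prop)] at h2
    rw [show (fun z => √(v : ℝ) * z + m) = (fun x => x + m) ∘ fun x => √(v : ℝ) * x from rfl, h2]
    congr 1
    · ring
    · ext; simp
  have hpre : (fun z => √(v : ℝ) * z + m) ⁻¹' Ioi u = (Iic ((u - m) / √v))ᶜ := by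
    ext z
    simp only [mem_preimage, mem_Ioi, mem_compl_iff, mem_Iic, not_le, div_lt_iff₀ hs]
    constructor <;> intro h <;> linarith
  rw [h0, Measure.map_apply (by fun_prop) measurableSet_Ioi, hpre, prob_compl_eq_one_sub
    measurableSet_Iic, Phi, cdf_eq_real, ENNReal.ofReal_sub _ measureReal_nonneg,
    ofReal_measureReal, ENNReal.ofReal_one]

theorem measurable_gaussianReal_Ioi {v : ℝ≥0} (hv : v ≠ 0) :
    Measurable fun y => gaussianReal 0 v (Ioi y) := by
  simp_rw [gaussianReal_Ioi 0 hv]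
  have : Measurable Phi := (monotone_cdf _).measurable
  fun_prop

theorem Phi_nonneg (u : ℝ) : 0 ≤ Phi u := cdf_nonneg _ _

theorem Phi_le_one (u : ℝ) : Phi u ≤ 1 := cdf_le_one _ _

theorem hasDerivAt_gaussianPDFReal_zero {v : ℝ≥0} (hv : v ≠ 0) (y : ℝ) :
    HasDerivAt (fun y => -(v * gaussianPDFReal 0 v y)) (y * gaussianPDFReal 0 v y) y := by
  have hv' : (v : ℝ) ≠ 0 := by exact_mod_cast hv
  unfold gaussianPDFReal
  have h : HasDerivAt (fun y : ℝ => -(y - 0) ^ 2 / (2 * (v : ℝ))) (-y / v) y := by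
    have := (((hasDerivAt_id y).sub_const 0).pow 2).neg.div_const (2 * (v : ℝ))
    convert! this using 1
    simp; field_simp
  convert! ((h.exp.const_mul (√(2 * Real.pi * v))⁻¹).const_mul (v : ℝ)).neg using 1
  field_simp

theorem tendsto_gaussianPDFReal_zero_atTop {v : ℝ≥0} (hv : v ≠ 0) :
    Tendsto (gaussianPDFReal 0 v) atTop (𝓝 0) := by
  have hv' : 0 < (v : ℝ) := by positivity
  unfold gaussianPDFReal
  have h : Tendsto (fun y : ℝ => -(y - 0) ^ 2 / (2 * (v : ℝ))) atTop atBot := by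
    have := (tendsto_neg_atTop_atBot.comp (tendsto_pow_atTop (α := ℝ) two_ne_zero)).atBot_div_const
      (show 0 < 2 * (v : ℝ) by positivity)
    simpa using this
  simpa using (Real.tendsto_exp_atBot.comp h).const_mul (√(2 * Real.pi * v))⁻¹

/-- Mills' ratio inequality. -/
theorem gaussianReal_Ioi_le {v : ℝ≥0} (hv : v ≠ 0) {y : ℝ} (hy : 0 < y) :
    gaussianReal 0 v (Ioi y) ≤ ENNReal.ofReal (v / y * gaussianPDFReal 0 v y) := by
  have hpos : ∀ z ∈ Ioi y, 0 ≤ z * gaussianPDFReal 0 v z := fun z hz =>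
    mul_nonneg (hy.le.trans (le_of_lt hz)) (gaussianPDFReal_nonneg _ _ _)
  have hlim : Tendsto (fun y => -(v * gaussianPDFReal 0 v y)) atTop (𝓝 0) := by
    simpa using ((tendsto_gaussianPDFReal_zero_atTop hv).const_mul (v : ℝ)).neg
  have hint : ∫ z in Ioi y, z * gaussianPDFReal 0 v z = v * gaussianPDFReal 0 v y := by
    rw [integral_Ioi_of_hasDerivAt_of_nonneg' (fun z _ => hasDerivAt_gaussianPDFReal_zero hv z)
      hpos hlim]
    ring
  have hio : IntegrableOn (fun z => z * gaussianPDFReal 0 v z) (Ioi y) :=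
    integrableOn_Ioi_deriv_of_nonneg' (fun z _ => hasDerivAt_gaussianPDFReal_zero hv z) hpos hlim
  rw [gaussianReal_apply _ hv]
  -- On `(y, ∞)` one has `1 ≤ z / y`, and `z` times the density has an explicit primitive.
  calc _ ≤ ∫⁻ z in Ioi y, ENNReal.ofReal (y⁻¹ * (z * gaussianPDFReal 0 v z)) := by
        refine setLIntegral_mono (by
          have := measurable_gaussianPDFReal 0 v
          fun_prop) fun z hz => ?_
        refine ENNReal.ofReal_le_ofReal ?_
        have h1 : 1 ≤ y⁻¹ * z := by
          rw [inv_mul_eq_div, one_le_div hy]; exact le_of_lt hz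
        have := gaussianPDFReal_nonneg 0 v z
        nlinarith
    _ = _ := by
        rw [← ofReal_integral_eq_lintegral_ofReal (hio.const_mul _), integral_const_mul, hint]
        · congr 1; field_simp
        · filter_upwards [self_mem_ae_restrict measurableSet_Ioi] with z hz
          exact mul_nonneg (inv_nonneg.2 hy.le) (hpos z hz)

/-- Completing the square: the weight `e^y` shifts the mean by the variance. This produces `e^{b/2}`
and the `-b` inside `Φ` in (1). -/
theorem exp_mul_gaussianPDFReal (v : ℝ≥0) (y : ℝ) :
    Real.exp y * gaussianPDFReal 0 v y = Real.exp (v / 2) * gaussianPDFReal v v y := by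
  by_cases hv : v = 0
  · subst hv; simp
  have hv' : (v : ℝ) ≠ 0 := by exact_mod_cast hv
  unfold gaussianPDFReal
  rw [mul_left_comm, mul_left_comm (Real.exp _), ← Real.exp_add, ← Real.exp_add]
  congr 2
  field_simp
  ring

theorem lintegral_exp_mul_gaussianReal_Ioi_le {v : ℝ≥0} (hv : v ≠ 0) {a : ℝ} (ha : 0 < a) :
    ∫⁻ y in Ioi a, ENNReal.ofReal (Real.exp y) * gaussianReal 0 v (Ioi y)
      ≤ ENNReal.ofReal (v / a * Real.exp (v / 2) * (1 - Phi ((a - v) / √v))) := by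
  have hm := measurable_gaussianPDFReal v v
  have hc : 0 ≤ v / a * Real.exp (v / 2) := by positivity
  rw [ENNReal.ofReal_mul hc, ← gaussianReal_Ioi _ hv, gaussianReal_apply _ hv,
    ← lintegral_const_mul _ (measurable_gaussianPDF _ _)]
  refine setLIntegral_mono (by unfold gaussianPDF; fun_prop) fun y hy => ?_
  have hy0 : 0 < y := ha.trans hy
  refine (mul_le_mul_right (gaussianReal_Ioi_le hv hy0) _).trans ?_
  unfold gaussianPDF
  rw [← ENNReal.ofReal_mul (Real.exp_nonneg _), ← ENNReal.ofReal_mul hc]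
  refine ENNReal.ofReal_le_ofReal ?_
  rw [mul_left_comm, exp_mul_gaussianPDFReal, ← mul_assoc]
  have := gaussianPDFReal_nonneg v v y
  have h2 : a ≤ y := le_of_lt hy
  gcongr

theorem setLIntegral_comp_log (g : ℝ → ℝ≥0∞) (c x : ℝ) :
    ∫⁻ u in Ioi (Real.exp (-x)), g (c + Real.log u)
      = ∫⁻ y in Ioi (c - x), ENNReal.ofReal (Real.exp (y - c)) * g y := by
  have him : (fun y => Real.exp (y - c)) '' Ioi (c - x) = Ioi (Real.exp (-x)) := by
    ext u
    simp only [mem_image, mem_Ioi]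
    constructor
    · rintro ⟨y, hy, rfl⟩
      exact Real.exp_lt_exp.2 (by linarith)
    · intro hu
      have hu0 : 0 < u := (Real.exp_pos _).trans hu
      refine ⟨Real.log u + c, ?_, by simp [Real.exp_log hu0]⟩
      have := (Real.lt_log_iff_exp_lt hu0).2 hu
      linarith
  rw [← him, lintegral_image_eq_lintegral_abs_deriv_mul (f' := fun y => Real.exp (y - c))
    measurableSet_Ioi]
  · refine setLIntegral_congr_fun measurableSet_Ioi fun y _ => ?_
    simp
  · intro y _
    simpa using (((hasDerivAt_id y).sub_const c).exp).hasDerivWithinAt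
  · intro y _ z _ h
    simpa using h

/-- The Jacobian `e^{y-c}` of `u = e^{y-c}` supplies both the factor `e^{-c}` and the weight `e^y`;
the lower limit becomes `c - x`. -/
theorem setLIntegral_gaussianReal_Ioi_log_le {v : ℝ≥0} (hv : v ≠ 0) {c x : ℝ} (hxc : x < c) :
    ∫⁻ u in Ioi (Real.exp (-x)), 4 * gaussianReal 0 v (Ioi (c + Real.log u))
      ≤ ENNReal.ofReal (condBound v c x) := by
  have hm := measurable_gaussianReal_Ioi hv
  rw [setLIntegral_comp_log (fun y => 4 * gaussianReal 0 v (Ioi y))]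
  have h : ∀ y, ENNReal.ofReal (Real.exp (y - c)) * (4 * gaussianReal 0 v (Ioi y))
      = ENNReal.ofReal (4 * Real.exp (-c))
        * (ENNReal.ofReal (Real.exp y) * gaussianReal 0 v (Ioi y)) := fun y => by
    rw [sub_eq_neg_add, Real.exp_add, ENNReal.ofReal_mul (Real.exp_nonneg _),
      ENNReal.ofReal_mul (by norm_num)]
    simp
    ring
  simp_rw [h]
  rw [lintegral_const_mul _ (by fun_prop)]
  refine (mul_le_mul_right (lintegral_exp_mul_gaussianReal_Ioi_le hv (sub_pos.2 hxc)) _).trans ?_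
  rw [← ENNReal.ofReal_mul (by positivity)]
  refine ENNReal.ofReal_le_ofReal (le_of_eq ?_)
  unfold condBound
  ring

theorem condBound_nonneg {b c x : ℝ} (hb : 0 ≤ b) (hxc : x ≤ c) : 0 ≤ condBound b c x := by
  have := sub_nonneg.2 (Phi_le_one ((c - x - b) / √b))
  have := sub_nonneg.2 hxc
  unfold condBound
  positivity

theorem gaussianReal_Iic_zero (v : ℝ≥0) : gaussianReal 0 v (Iic 0) = gaussianReal 0 v (Ici 0) := by
  conv_lhs => rw [← neg_zero, ← gaussianReal_map_neg, Measure.map_apply measurable_neg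
    measurableSet_Iic]
  simp

theorem one_le_two_mul_gaussianReal_Ici (v : ℝ≥0) : 1 ≤ 2 * gaussianReal 0 v (Ici 0) := by
  calc 1 = gaussianReal 0 v (Iic 0 ∪ Ici 0) := by rw [Iic_union_Ici, measure_univ]
    _ ≤ gaussianReal 0 v (Iic 0) + gaussianReal 0 v (Ici 0) := measure_union_le _ _
    _ = _ := by rw [gaussianReal_Iic_zero, two_mul]

theorem half_le_Phi {u : ℝ} (hu : 0 ≤ u) : 1 / 2 ≤ Phi u := by
  have h1 := one_le_two_mul_gaussianReal_Ici 1
  rw [← gaussianReal_Iic_zero, ← ofReal_measureReal (μ := gaussianReal 0 1), ← cdf_eq_real,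
    show (2 : ℝ≥0∞) = ENNReal.ofReal 2 by simp, ← ENNReal.ofReal_mul (by norm_num),
    ENNReal.one_le_ofReal] at h1
  have h2 : cdf (gaussianReal 0 1) 0 ≤ Phi u := monotone_cdf _ hu
  linarith

/-! ### Lévy's maximal inequality, one- and two-sided -/

section MaximalInequality

variable {Ω : Type*} [MeasurableSpace Ω] {P : Measure Ω}

section OneSided

variable {B : ℝ≥0 → Ω → ℝ} (hB : IsPreBrownianReal B P)
  (hm : ∀ t, Measurable (B t))

include hB hm

/-- The increment after `t` is independent of the path up to `t` and symmetric, hence nonnegative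
with probability at least `1/2`. The weak inequality also covers `t = T`. -/
theorem measure_le_two_mul_inter_future {t T : ℝ≥0} (htT : t ≤ T) {A : Set Ω}
    (hA : MeasurableSet[(inferInstance : MeasurableSpace (Iic t → ℝ)).comap
      (fun ω (s : Iic t) => B s ω)] A) :
    P A ≤ 2 * P (A ∩ {ω | 0 ≤ B T ω - B t ω}) := by
  obtain ⟨A', hA', rfl⟩ := hA
  have hi : IndepFun (fun ω (s : Iic t) => B s ω) (B T - B t) P := by
    have := (hB.indepFun_shift t).symm.comp measurable_id (measurable_pi_apply (T - t))
    refine (show B T - B t = _ from ?_) ▸ this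
    ext ω
    simp [add_tsub_cancel_of_le htT]
  have hset : {ω | 0 ≤ B T ω - B t ω} = (B T - B t) ⁻¹' Ici 0 := rfl
  rw [hset, hi.measure_inter_preimage_eq_mul _ _ hA' measurableSet_Ici, mul_left_comm,
    ← Measure.map_apply ((hm T).sub (hm t)) measurableSet_Ici, (hB.hasLaw_sub T t).map_eq]
  exact le_mul_of_one_le_right' (one_le_two_mul_gaussianReal_Ici _)

theorem measure_exists_finset_lt_le (F : Finset ℝ≥0) {T : ℝ≥0} (hF : ∀ t ∈ F, t ≤ T) (u : ℝ) :
    P {ω | ∃ t ∈ F, u < B t ω} ≤ 2 * P {ω | u < B T ω} := by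
  -- First passage decomposition: on `A t`, the first time in `F` above `u` is `t`. These events are
  -- disjoint, determined by the past of `t`, and a nonnegative later increment leaves `B T` above
  -- `u`.
  set A : ℝ≥0 → Set Ω := fun t => {ω | u < B t ω ∧ ∀ s ∈ F, s < t → B s ω ≤ u}
  have hAm : ∀ t, MeasurableSet[(inferInstance : MeasurableSpace (Iic t → ℝ)).comap
      (fun ω (s : Iic t) => B s ω)] (A t) := fun t => by
    refine ⟨{p | u < p ⟨t, mem_Iic.2 le_rfl⟩} ∩
      ⋂ s ∈ F, {p | ∀ h : s < t, p ⟨s, h.le⟩ ≤ u}, ?_, ?_⟩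
    · refine (measurableSet_lt measurable_const (measurable_pi_apply _)).inter
        (F.measurableSet_biInter fun s _ => ?_)
      by_cases h : s < t
      · simp only [h, forall_true_left]
        exact measurableSet_le (measurable_pi_apply _) measurable_const
      · simp [h]
    · ext ω
      simp [A]
  have hAm' : ∀ t, MeasurableSet (A t) := fun t =>
    (measurable_pi_lambda _ fun s => hm _).comap_le _ (hAm t)
  have hcover : {ω | ∃ t ∈ F, u < B t ω} ⊆ ⋃ t ∈ F, A t := by
    rintro ω ⟨t, ht, hut⟩
    classical
    have hne : (F.filter fun s => u < B s ω).Nonempty := ⟨t, by simp [ht, hut]⟩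
    obtain ⟨s, hs, hmin⟩ := (F.filter fun s => u < B s ω).exists_min_image id hne
    simp only [Finset.mem_filter] at hs hmin
    simp only [mem_iUnion]
    refine ⟨s, hs.1, hs.2, fun r hr hrs => ?_⟩
    by_contra hlt
    exact absurd (hmin r ⟨hr, not_le.1 hlt⟩) (not_le.2 hrs)
  have hdisj : (F : Set ℝ≥0).PairwiseDisjoint fun t => A t ∩ {ω | 0 ≤ B T ω - B t ω} := by
    intro s hs t ht hst
    refine Set.disjoint_left.2 ?_
    rintro ω ⟨⟨h1, h2⟩, -⟩ ⟨⟨h3, h4⟩, -⟩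
    rcases lt_or_gt_of_ne hst with h | h
    · exact absurd (h4 s hs h) (not_le.2 h1)
    · exact absurd (h2 t ht h) (not_le.2 h3)
  calc _ ≤ ∑ t ∈ F, P (A t) := (measure_mono hcover).trans (measure_biUnion_finset_le _ _)
    _ ≤ ∑ t ∈ F, 2 * P (A t ∩ {ω | 0 ≤ B T ω - B t ω}) :=
        Finset.sum_le_sum fun t ht => measure_le_two_mul_inter_future hB hm (hF t ht) (hAm t)
    _ = 2 * P (⋃ t ∈ F, A t ∩ {ω | 0 ≤ B T ω - B t ω}) := by
        rw [measure_biUnion_finset hdisj fun t _ => (hAm' t).inter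
          (measurableSet_le measurable_const ((hm T).sub (hm t))), Finset.mul_sum]
    _ ≤ _ := by
        gcongr
        refine iUnion₂_subset fun t _ => ?_
        rintro ω ⟨⟨h1, -⟩, h2⟩
        simp only [mem_ofPred_eq] at h2 ⊢
        linarith

/-- Lévy's maximal inequality for Brownian motion along a countable set of times. -/
theorem measure_exists_lt_le (d : ℕ → ℝ≥0) {T : ℝ≥0} (hd : ∀ n, d n ≤ T) (u : ℝ) :
    P {ω | ∃ n, u < B (d n) ω} ≤ 2 * gaussianReal 0 T (Ioi u) := by
  have hU : {ω | ∃ n, u < B (d n) ω}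
      = ⋃ N : ℕ, {ω | ∃ t ∈ (Finset.range N).image d, u < B t ω} := by
    ext ω
    simp only [mem_ofPred_eq, mem_iUnion, Finset.mem_image, Finset.mem_range]
    constructor
    · rintro ⟨n, hn⟩
      exact ⟨n + 1, d n, ⟨n, by simp, rfl⟩, hn⟩
    · rintro ⟨N, t, ⟨n, -, rfl⟩, hn⟩
      exact ⟨n, hn⟩
  have hmono : Monotone fun N : ℕ => {ω | ∃ t ∈ (Finset.range N).image d, u < B t ω} := by
    intro M N hMN ω
    rintro ⟨t, ht, hut⟩
    exact ⟨t, Finset.image_subset_image (Finset.range_mono hMN) ht, hut⟩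
  rw [hU, hmono.measure_iUnion]
  refine iSup_le fun N => ?_
  rw [← (hB.hasLaw_eval T).map_eq, Measure.map_apply (hm T) measurableSet_Ioi]
  refine measure_exists_finset_lt_le hB hm _ (fun t ht => ?_) u
  obtain ⟨n, -, rfl⟩ := Finset.mem_image.1 ht
  exact hd n

end OneSided

section TwoSided

variable {W : ℝ → Ω → ℝ} (hW : IsTwoSidedBrownian W P)
  (d : ℕ → ℝ) {b : ℝ} (hd : ∀ n, d n ∈ Icc (-b) b)

include hW hd

theorem IsTwoSidedBrownian.measure_exists_lt_le (u : ℝ) :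
    -- The constant `4` is `2` for each half-line.
    P {ω | ∃ n, u < W (d n) ω} ≤ 4 * gaussianReal 0 b.toNNReal (Ioi u) := by
  have hr := BrownResnick.measure_exists_lt_le hW.right.toIsPreBrownianReal
    (fun t => hW.measurable _) (fun n => (d n).toNNReal) (T := b.toNNReal)
    (fun n => Real.toNNReal_le_toNNReal (hd n).2) u
  have hl := BrownResnick.measure_exists_lt_le hW.left.toIsPreBrownianReal
    (fun t => hW.measurable _) (fun n => (-d n).toNNReal) (T := b.toNNReal)
    (fun n => Real.toNNReal_le_toNNReal (by linarith [(hd n).1])) u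
  rw [show (4 : ℝ≥0∞) = 2 + 2 by norm_num, add_mul]
  refine le_trans (measure_mono ?_) ((measure_union_le _ _).trans (add_le_add hr hl))
  rintro ω ⟨n, hn⟩
  rcases le_total 0 (d n) with h | h
  · exact Or.inl ⟨n, by simpa [Real.coe_toNNReal _ h] using hn⟩
  · exact Or.inr ⟨n, by simpa [Real.coe_toNNReal _ (neg_nonneg.2 h)] using hn⟩

variable [IsProbabilityMeasure P] in
theorem IsTwoSidedBrownian.sq_le_measureReal_forall_le (hb : 0 < b) {c : ℝ} (hc : c ≤ 0) :
    (2 * Phi (-c / √b) - 1) ^ 2 ≤ P.real {ω | ∀ n, c ≤ W (d n) ω} := by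
  have hv : b.toNNReal ≠ 0 := (Real.toNNReal_pos.2 hb).ne'
  have key : ∀ (B : ℝ≥0 → Ω → ℝ), IsPreBrownianReal B P → (∀ t, Measurable (B t)) →
      ∀ e : ℕ → ℝ≥0, (∀ n, e n ≤ b.toNNReal) →
      2 * Phi (-c / √b) - 1 ≤ P.real {ω | ∀ n, c ≤ B (e n) ω} := by
    intro B hB hm e he
    have h := BrownResnick.measure_exists_lt_le hB.neg (fun t => (hm t).neg) e he (-c)
    rw [gaussianReal_Ioi _ hv, Real.coe_toNNReal _ hb.le, sub_zero,
      show (2 : ℝ≥0∞) = ENNReal.ofReal 2 by simp, ← ENNReal.ofReal_mul (by norm_num)] at h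
    have h1 := ENNReal.toReal_le_of_le_ofReal
      (mul_nonneg zero_le_two (sub_nonneg.2 (Phi_le_one _))) h
    have hset : {ω | ∃ n, -c < (-B) (e n) ω} = {ω | ∀ n, c ≤ B (e n) ω}ᶜ := by
      ext ω; simp
    have hmeas : MeasurableSet {ω | ∀ n, c ≤ B (e n) ω} := by
      rw [ofPred_forall]
      exact MeasurableSet.iInter fun n => measurableSet_le measurable_const (hm _)
    rw [hset, ← measureReal_def, probReal_compl_eq_one_sub hmeas] at h1
    linarith
  have hr := key _ hW.right.toIsPreBrownianReal (fun t => hW.measurable _)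
    (fun n => (d n).toNNReal) (fun n => Real.toNNReal_le_toNNReal (hd n).2)
  have hl := key _ hW.left.toIsPreBrownianReal (fun t => hW.measurable _)
    (fun n => (-d n).toNNReal) (fun n => Real.toNNReal_le_toNNReal (by linarith [(hd n).1]))
  have hS : ∀ e : ℕ → ℝ≥0, MeasurableSet {p : ℝ≥0 → ℝ | ∀ n, c ≤ p (e n)} := fun e => by
    rw [ofPred_forall]
    exact MeasurableSet.iInter fun n => measurableSet_le measurable_const (measurable_pi_apply _)
  have hind := hW.indep.measure_inter_preimage_eq_mul _ _
    (hS fun n => (d n).toNNReal) (hS fun n => (-d n).toNNReal)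
  -- Nonnegativity, where `c ≤ 0` enters, permits multiplying the bounds for the two independent
  -- halves.
  have h0 : 0 ≤ 2 * Phi (-c / √b) - 1 := by
    have := half_le_Phi (div_nonneg (neg_nonneg.2 hc) (Real.sqrt_nonneg b))
    linarith
  rw [sq]
  refine (mul_le_mul hr hl h0 measureReal_nonneg).trans ?_
  rw [measureReal_def, measureReal_def, ← ENNReal.toReal_mul]
  refine (le_of_eq (congrArg ENNReal.toReal hind.symm)).trans ?_
  refine measureReal_mono ?_
  rintro ω ⟨h1, h2⟩ n
  rcases le_total 0 (d n) with h | h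
  · simpa [Real.coe_toNNReal _ h] using h1 n
  · simpa [Real.coe_toNNReal _ (neg_nonneg.2 h)] using h2 n

end TwoSided

end MaximalInequality

/-! ### Pathwise arguments and reduction to countably many times -/

section Paths

variable {Ω : Type*} {Y : ℕ → Ω → ℝ} {W : ℕ → ℝ → Ω → ℝ} {k : ℕ} {ω : Ω}

theorem component_le_Zk {i : ℕ} (hi : i < k) (t : ℝ) :
    component Y W i t ω ≤ Zk Y W k t ω :=
  le_ciSup (f := fun i : Fin k => component Y W i t ω) (Finite.bddAbove_range _) ⟨i, hi⟩

theorem continuous_Zk (hk : 1 ≤ k) (hc : ∀ i, Continuous fun t => W i t ω) :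
    Continuous fun t => Zk Y W k t ω := by
  have : Nonempty (Fin k) := ⟨⟨0, hk⟩⟩
  have h : ∀ t, Zk Y W k t ω
      = Finset.univ.sup' Finset.univ_nonempty fun i : Fin k => component Y W i t ω := fun t => by
    rw [Finset.sup'_univ_eq_ciSup]; rfl
  simp_rw [h]
  refine Continuous.finset_sup'_apply _ fun i _ => ?_
  have := hc i
  unfold component
  fun_prop

theorem bddBelow_range_Zk_add (hk : 1 ≤ k) (hc : ∀ i, Continuous fun t => W i t ω) (b : ℝ) :
    BddBelow (range fun t : Icc (-b) b => Zk Y W k t ω + |(t : ℝ)| / 2) := by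
  have h1 := continuous_Zk (Y := Y) hk hc
  have h : Continuous fun t => Zk Y W k t ω + |t| / 2 := by fun_prop
  have := (isCompact_Icc (a := -b) (b := b)).bddBelow_image h.continuousOn
  rwa [image_eq_range] at this

/-- `C_k` computed along the sequence of times `d`. -/
noncomputable def seqInf (Y : ℕ → Ω → ℝ) (W : ℕ → ℝ → Ω → ℝ) (d : ℕ → ℝ) (k : ℕ) (ω : Ω) : ℝ :=
  ⨅ n, (Zk Y W k (d n) ω + |d n| / 2)

/-- By continuity the infimum may be taken along a dense sequence, which makes it measurable in the
first `k` inputs. Boundedness below, from compactness, rules out the default value of the real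
infimum. -/
theorem Ck_eq_seqInf (hk : 1 ≤ k) (hc : ∀ i, Continuous fun t => W i t ω) {b : ℝ}
    {d : ℕ → Icc (-b) b} (hd : DenseRange d) :
    Ck Y W b k ω = seqInf Y W (fun n => d n) k ω := by
  have h1 := continuous_Zk (Y := Y) hk hc
  have h : Continuous fun t : Icc (-b) b => Zk Y W k t ω + |(t : ℝ)| / 2 := by fun_prop
  have hb := bddBelow_range_Zk_add (Y := Y) hk hc b
  have hne : Nonempty (Icc (-b) b) := ⟨d 0⟩
  refine le_antisymm (le_ciInf fun n => ciInf_le hb (d n)) (le_ciInf fun t => ?_)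
  have hbd : BddBelow (range fun n => Zk Y W k (d n) ω + |(d n : ℝ)| / 2) :=
    hb.mono (range_comp_subset_range d fun t : Icc (-b) b => Zk Y W k t ω + |(t : ℝ)| / 2)
  exact hd.induction_on (p := fun t : Icc (-b) b =>
    seqInf Y W (fun n => d n) k ω ≤ Zk Y W k t ω + |(t : ℝ)| / 2) t
    (isClosed_le continuous_const h) fun n => ciInf_le hbd n

theorem exists_component_gt_of_mem_errorEvent {b : ℝ} (hk : 1 ≤ k)
    (h : ω ∈ errorEvent Y W b k) :
    ∃ t ∈ Icc (-b) b, ∃ i, k ≤ i ∧ Zk Y W k t ω < component Y W i t ω := by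
  obtain ⟨t, ht, hne⟩ := h
  refine ⟨t, ht, ?_⟩
  by_contra! hcon
  have : Nonempty (Fin k) := ⟨⟨0, hk⟩⟩
  refine hne (le_antisymm ?_ (iSup_le fun i => ?_))
  · obtain ⟨i, hi⟩ := exists_eq_ciSup_of_finite (f := fun i : Fin k => component Y W i t ω)
    rw [Zk, ← hi]
    exact le_iSup (fun i : ℕ => (component Y W i t ω : EReal)) i
  · rcases lt_or_ge i k with hi | hi
    · exact EReal.coe_le_coe_iff.2 (component_le_Zk hi t)
    · exact EReal.coe_le_coe_iff.2 (hcon i hi)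

/-- The event that the path `W_{k+j}` lifts the point at `r + Y_k + ⋯ + Y_{k+j}` above `c`. -/
def exceed (Y : ℕ → Ω → ℝ) (W : ℕ → ℝ → Ω → ℝ) (d : ℕ → ℝ) (r c : ℝ) (k j : ℕ) : Set Ω :=
  {ω | ∃ n, c + Real.log (r + ∑ l ∈ Finset.range (j + 1), Y (k + l) ω) < W (k + j) (d n) ω}

theorem exists_mem_exceed (hk : 1 ≤ k) (hY : ∀ i, 0 < Y i ω)
    (hc : ∀ i, Continuous fun t => W i t ω) {b c x : ℝ}
    {d : ℕ → Icc (-b) b} (hd : DenseRange d) (hx : point Y k ω ≤ x) (hC : c < Ck Y W b k ω)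
    (hE : ω ∈ errorEvent Y W b k) :
    ∃ j, ω ∈ exceed Y W (fun n => d n) (Real.exp (-x)) c k j := by
  obtain ⟨t, ht, i, hki, hi⟩ := exists_component_gt_of_mem_errorEvent hk hE
  obtain ⟨j, rfl⟩ := Nat.exists_eq_add_of_le hki
  have h1 : Ck Y W b k ω ≤ Zk Y W k t ω + |t| / 2 :=
    ciInf_le (bddBelow_range_Zk_add (Y := Y) hk hc b) ⟨t, ht⟩
  have hS : 0 < ∑ i ∈ Finset.range k, Y i ω :=
    Finset.sum_pos (fun i _ => hY i) ⟨0, Finset.mem_range.2 hk⟩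
  have hT : 0 < ∑ l ∈ Finset.range (j + 1), Y (k + l) ω :=
    Finset.sum_pos (fun i _ => hY _) ⟨0, by simp⟩
  have hr : Real.exp (-x) ≤ ∑ i ∈ Finset.range k, Y i ω := by
    rw [point, one_div, Real.log_inv] at hx
    rw [← Real.le_log_iff_exp_le hS]
    linarith
  have hp : point Y (k + j + 1) ω ≤
      -Real.log (Real.exp (-x) + ∑ l ∈ Finset.range (j + 1), Y (k + l) ω) := by
    rw [point, one_div, Real.log_inv, add_assoc, Finset.sum_range_add]
    exact neg_le_neg (Real.log_le_log (by positivity) (by gcongr))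
  have hw : c + Real.log (Real.exp (-x) + ∑ l ∈ Finset.range (j + 1), Y (k + l) ω)
      < W (k + j) t ω := by
    unfold component at hi
    linarith
  have hcont : Continuous fun s : Icc (-b) b => W (k + j) s ω := (hc _).comp continuous_subtype_val
  -- The strict inequality is an open condition on the time, so it also holds at some point of the
  -- dense sequence.
  obtain ⟨n, hn⟩ := hd.exists_mem_open (isOpen_lt continuous_const hcont) ⟨⟨t, ht⟩, hw⟩
  exact ⟨j, n, hn⟩

theorem lt_Ck (hk : 1 ≤ k) (hc : ∀ i, Continuous fun t => W i t ω) {b c : ℝ} {d : ℕ → Icc (-b) b}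
    (hd : DenseRange d) (hX : c / 2 < point Y 1 ω) (hW : ∀ n, c / 2 ≤ W 0 (d n) ω) :
    c < Ck Y W b k ω := by
  rw [Ck_eq_seqInf hk hc hd]
  refine lt_of_lt_of_le (b := point Y 1 ω + c / 2) (by linarith) (le_ciInf fun n => ?_)
  have := component_le_Zk (Y := Y) (W := W) (ω := ω) (i := 0) hk (d n)
  have := hW n
  simp only [component, zero_add] at *
  linarith

end Paths

/-! ### Measurability with respect to early or late inputs -/

section Measurability

variable {Ω : Type*} [MeasurableSpace Ω] {Y : ℕ → Ω → ℝ} {W : ℕ → ℝ → Ω → ℝ} {k : ℕ}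

theorem measurable_point (hY : ∀ i < k, Measurable (Y i)) : Measurable (point Y k) := by
  have : Measurable fun ω => ∑ i ∈ Finset.range k, Y i ω :=
    Finset.measurable_sum _ fun i hi => hY i (Finset.mem_range.1 hi)
  unfold point
  fun_prop

theorem measurable_seqInf (hY : ∀ i < k, Measurable (Y i)) (hW : ∀ i < k, ∀ t, Measurable (W i t))
    (d : ℕ → ℝ) : Measurable (seqInf Y W d k) := by
  unfold seqInf Zk component
  refine Measurable.iInf fun n => Measurable.add_const (Measurable.iSup fun i => ?_) _
  have h1 := hW i i.2 (d n)
  have h2 : Measurable (point Y ((i : ℕ) + 1)) :=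
    measurable_point fun l hl => hY l (by omega)
  fun_prop

/-- Only indices below `k` are assumed measurable (in `measurableSet_exceed`, only those from `k`
on), so that the σ-algebra on `Ω` can later be replaced by one generated by the early or the late
inputs. -/
theorem measurableSet_point_le_lt_seqInf (hY : ∀ i < k, Measurable (Y i))
    (hW : ∀ i < k, ∀ t, Measurable (W i t)) (d : ℕ → ℝ) (c x : ℝ) :
    MeasurableSet {ω | point Y k ω ≤ x ∧ c < seqInf Y W d k ω} :=
  (measurableSet_le (measurable_point hY) measurable_const).inter
    (measurableSet_lt measurable_const (measurable_seqInf hY hW d))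

theorem measurableSet_exceed (hY : ∀ i, k ≤ i → Measurable (Y i))
    (hW : ∀ i, k ≤ i → ∀ t, Measurable (W i t)) (d : ℕ → ℝ) (r c : ℝ) (j : ℕ) :
    MeasurableSet (exceed Y W d r c k j) := by
  have hS : Measurable fun ω => ∑ l ∈ Finset.range (j + 1), Y (k + l) ω :=
    Finset.measurable_sum _ fun i _ => hY _ (by omega)
  unfold exceed
  rw [ofPred_exists]
  exact MeasurableSet.iUnion fun n => measurableSet_lt (by fun_prop) (hW _ (by omega) _)

end Measurability

/-! ### Independence of early and late inputs -/

theorem iIndepFun_bool {Ω : Type*} [MeasurableSpace Ω] {P : Measure Ω} [IsProbabilityMeasure P]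
    {β : Bool → Type*} [∀ i, MeasurableSpace (β i)] {f : ∀ i, Ω → β i}
    (h : IndepFun (f true) (f false) P) : iIndepFun f P := by
  rw [iIndepFun_iff_measure_inter_preimage_eq_mul]
  intro S sets hS
  have : S = ∅ ∨ S = {true} ∨ S = {false} ∨ S = {true, false} := by
    clear hS; revert S; decide
  rcases this with rfl | rfl | rfl | rfl
  · simp
  · simp
  · simp
  · rw [Finset.prod_pair (by simp), Finset.set_biInter_insert, Finset.set_biInter_singleton]
    exact h.measure_inter_preimage_eq_mul _ _ (hS true (by simp)) (hS false (by simp))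

section Independence

variable {Ω : Type*} [MeasurableSpace Ω] {P : Measure Ω} [IsProbabilityMeasure P]
  {Y : ℕ → Ω → ℝ} {W : ℕ → ℝ → Ω → ℝ}

/-- Waiting times and paths, both regarded as random functions on the line. -/
def inputFun (Y : ℕ → Ω → ℝ) (W : ℕ → ℝ → Ω → ℝ) : Bool → ℕ → Ω → ℝ → ℝ
  | true, i, ω => fun _ => Y i ω
  | false, i, ω => fun t => W i t ω

variable (h : IsInput Y W P)
include h

omit [IsProbabilityMeasure P] in
theorem IsInput.measurable_inputFun (β : Bool) (i : ℕ) : Measurable (inputFun Y W β i) := by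
  cases β
  · exact measurable_pi_lambda _ fun t => (h.brownian_W i).measurable t
  · exact measurable_pi_lambda _ fun _ => h.measurable_Y i

/-- Independence within each family and between the two families combines into joint independence
over `Bool × ℕ`, so that disjoint index sets generate independent σ-algebras. -/
theorem IsInput.iIndepFun_inputFun :
    iIndepFun (fun (p : Bool × ℕ) ω => inputFun Y W p.1 p.2 ω) P := by
  refine iIndepFun_uncurry' h.measurable_inputFun (iIndepFun_bool ?_) fun β => ?_
  · exact h.indep_Y_W.comp (_mβ' := inferInstance)
      (show Measurable fun (y : ℕ → ℝ) i (_ : ℝ) => y i by fun_prop) measurable_id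
  · cases β
    · exact h.indep_W
    · exact h.indep_Y.comp (fun _ y (_ : ℝ) => y) fun _ => by fun_prop

/-- The first `k` waiting times and paths are independent of the later ones. -/
theorem IsInput.measure_inter_exceed (d : ℕ → ℝ) (r c x : ℝ) (k j : ℕ) :
    P ({ω | point Y k ω ≤ x ∧ c < seqInf Y W d k ω} ∩ exceed Y W d r c k j)
      = P {ω | point Y k ω ≤ x ∧ c < seqInf Y W d k ω} * P (exceed Y W d r c k j) := by
  set m : Bool × ℕ → MeasurableSpace Ω := fun p =>
    (inferInstance : MeasurableSpace (ℝ → ℝ)).comap (inputFun Y W p.1 p.2)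
  have hind := indep_iSup_of_disjoint (S := {p : Bool × ℕ | p.2 < k}) (T := {p | k ≤ p.2})
    (fun p => (h.measurable_inputFun p.1 p.2).comap_le) h.iIndepFun_inputFun.iIndep
    (Set.disjoint_left.2 fun p (hp : p.2 < k) (hp' : k ≤ p.2) => absurd hp (not_lt.2 hp'))
  have hYm : ∀ (S : Set (Bool × ℕ)) i, (true, i) ∈ S → Measurable[⨆ p ∈ S, m p] (Y i) :=
    fun S i hi => Measurable.mono (ma := m (true, i))
      ((measurable_pi_apply (0 : ℝ)).comp (comap_measurable (inputFun Y W true i)))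
      (le_iSup₂_of_le (true, i) hi le_rfl) le_rfl
  have hWm : ∀ (S : Set (Bool × ℕ)) i, (false, i) ∈ S → ∀ t, Measurable[⨆ p ∈ S, m p] (W i t) :=
    fun S i hi t => Measurable.mono (ma := m (false, i))
      ((measurable_pi_apply t).comp (comap_measurable (inputFun Y W false i)))
      (le_iSup₂_of_le (false, i) hi le_rfl) le_rfl
  refine (Indep_iff _ _ _).1 hind _ _ ?_ ?_
  · exact @measurableSet_point_le_lt_seqInf _ (_) _ _ _ (fun i hi => hYm _ i hi)
      (fun i hi => hWm _ i hi) d c x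
  · exact @measurableSet_exceed _ (_) _ _ _ (fun i hi => hYm _ i hi) (fun i hi => hWm _ i hi)
      d r c j

end Independence

/-! ### The bounds (1), (2), (3) and the total error -/

theorem exists_denseRange_Icc {b : ℝ} (hb : 0 < b) : ∃ d : ℕ → Icc (-b) b, DenseRange d := by
  have : Nonempty (Icc (-b) b) := ⟨⟨0, by linarith, hb.le⟩⟩
  exact TopologicalSpace.exists_dense_seq _

section Bounds

variable {Ω : Type*} [MeasurableSpace Ω] {P : Measure Ω}

theorem IsTwoSidedBrownian.ae_continuous {W : ℝ → Ω → ℝ} (h : IsTwoSidedBrownian W P) :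
    ∀ᵐ ω ∂P, Continuous fun t => W t ω := by
  filter_upwards [h.right.cont, h.left.cont] with ω hr hl
  have hW : (fun t => W t ω)
      = fun t : ℝ => if 0 ≤ t then W (t.toNNReal : ℝ) ω else W (-((-t).toNNReal : ℝ)) ω := by
    ext t
    split_ifs with ht
    · rw [Real.coe_toNNReal _ ht]
    · rw [Real.coe_toNNReal _ (by linarith), neg_neg]
  rw [hW]
  refine Continuous.if_le (hr.comp continuous_real_toNNReal)
    (hl.comp (continuous_real_toNNReal.comp continuous_neg)) continuous_const continuous_id ?_
  rintro t rfl
  simp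

variable {Y : ℕ → Ω → ℝ} {W : ℕ → ℝ → Ω → ℝ} (h : IsInput Y W P)
include h

theorem IsInput.ae_continuous : ∀ᵐ ω ∂P, ∀ i, Continuous fun t => W i t ω :=
  ae_all_iff.2 fun i => (h.brownian_W i).ae_continuous

theorem IsInput.ae_pos : ∀ᵐ ω ∂P, ∀ i, 0 < Y i ω :=
  ae_all_iff.2 fun i =>
    ae_of_ae_map (h.measurable_Y i).aemeasurable ((h.law_Y i).map_eq.symm ▸ ae_pos_expMeasure_one)

variable [IsProbabilityMeasure P]

/-- The path is independent of the waiting times: the maximal inequality applies with their sum `T`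
frozen, and averaging over `T` amounts to `j + 1` steps of the walk from `r`. -/
theorem IsInput.measure_exceed_le {b : ℝ} (hb : 0 < b) {d : ℕ → ℝ} (hd : ∀ n, d n ∈ Icc (-b) b)
    (r c : ℝ) (k j : ℕ) :
    P (exceed Y W d r c k j) ≤
      (expStep^[j + 1] fun u => 4 * gaussianReal 0 b.toNNReal (Ioi (c + Real.log u))) r := by
  have hv : b.toNNReal ≠ 0 := (Real.toNNReal_pos.2 hb).ne'
  have hm := measurable_gaussianReal_Ioi hv
  have hgm : Measurable fun u => 4 * gaussianReal 0 b.toNNReal (Ioi (c + Real.log u)) :=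
    (hm.comp (Real.measurable_log.const_add c)).const_mul 4
  set T : Ω → ℝ := fun ω => ∑ l ∈ Finset.range (j + 1), Y (k + l) ω
  set ξ : Ω → ℕ → ℝ := fun ω n => W (k + j) (d n) ω
  have hT : Measurable T := Finset.measurable_sum _ fun i _ => h.measurable_Y _
  have hξ : Measurable ξ := measurable_pi_lambda _ fun n => (h.brownian_W _).measurable _
  have hind : IndepFun T ξ P := h.indep_Y_W.comp
    (show Measurable fun y : ℕ → ℝ => ∑ l ∈ Finset.range (j + 1), y (k + l) by fun_prop)
    (show Measurable fun (w : ℕ → ℝ → ℝ) n => w (k + j) (d n) by fun_prop)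
  have hset : MeasurableSet {p : ℝ × (ℕ → ℝ) | ∃ n, c + Real.log (r + p.1) < p.2 n} := by
    rw [ofPred_exists]
    exact MeasurableSet.iUnion fun n => measurableSet_lt (by fun_prop) (by fun_prop)
  have h1 : P (exceed Y W d r c k j)
      = (P.map fun ω => (T ω, ξ ω)) {p | ∃ n, c + Real.log (r + p.1) < p.2 n} := by
    rw [Measure.map_apply (hT.prodMk hξ) hset]; rfl
  rw [h1, (indepFun_iff_map_prod_eq_prod_map_map hT.aemeasurable hξ.aemeasurable).1 hind,
    Measure.prod_apply hset]
  have h2 : ∀ t, (P.map ξ) (Prod.mk t ⁻¹' {p | ∃ n, c + Real.log (r + p.1) < p.2 n})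
      ≤ 4 * gaussianReal 0 b.toNNReal (Ioi (c + Real.log (r + t))) := fun t => by
    rw [Measure.map_apply hξ (measurable_prodMk_left hset)]
    exact (h.brownian_W (k + j)).measure_exists_lt_le d hd _
  refine (lintegral_mono h2).trans ?_
  rw [lintegral_map (f := fun t => 4 * gaussianReal 0 b.toNNReal (Ioi (c + Real.log (r + t))))
    (hgm.comp (measurable_const_add r)) hT]
  exact (lintegral_walk (fun l => h.measurable_Y (k + l)) (fun l => h.law_Y (k + l))
    (h.indep_Y.precomp (add_right_injective k)) r (j + 1) hgm).le

theorem IsInput.tsum_measure_exceed_le {b : ℝ} (hb : 0 < b) {d : ℕ → ℝ}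
    (hd : ∀ n, d n ∈ Icc (-b) b) {c x : ℝ} (hxc : x < c) (k : ℕ) :
    ∑' j, P (exceed Y W d (Real.exp (-x)) c k j) ≤ ENNReal.ofReal (condBound b c x) := by
  have hv : b.toNNReal ≠ 0 := (Real.toNNReal_pos.2 hb).ne'
  have hm := measurable_gaussianReal_Ioi hv
  have hgm : Measurable fun u => 4 * gaussianReal 0 b.toNNReal (Ioi (c + Real.log u)) :=
    (hm.comp (Real.measurable_log.const_add c)).const_mul 4
  have hI := setLIntegral_gaussianReal_Ioi_log_le hv hxc
  rw [Real.coe_toNNReal _ hb.le] at hI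
  refine le_trans ?_ hI
  rw [ENNReal.tsum_eq_iSup_nat]
  exact iSup_le fun n => (Finset.sum_le_sum fun j _ => h.measure_exceed_le hb hd _ _ _ _).trans
    (sum_iterate_expStep_le hgm n _)

theorem IsInput.measure_inter_errorEvent_le {b : ℝ} (hb : 0 < b) {d : ℕ → Icc (-b) b}
    (hd : DenseRange d) {c x : ℝ} (hxc : x < c) {k : ℕ} (hk : 1 ≤ k) :
    P ({ω | point Y k ω ≤ x ∧ c < seqInf Y W (fun n => d n) k ω} ∩ errorEvent Y W b k)
      ≤ P {ω | point Y k ω ≤ x ∧ c < seqInf Y W (fun n => d n) k ω}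
        * ENNReal.ofReal (condBound b c x) := by
  set A := {ω | point Y k ω ≤ x ∧ c < seqInf Y W (fun n => d n) k ω}
  -- Only upper bounds on the measure of the error event are used, so its measurability is not
  -- needed.
  have hsub : (A ∩ errorEvent Y W b k : Set Ω)
      ≤ᵐ[P] (⋃ j, A ∩ exceed Y W (fun n => d n) (Real.exp (-x)) c k j : Set Ω) := by
    filter_upwards [h.ae_continuous, h.ae_pos] with ω hc hp hω
    obtain ⟨⟨h1, h2⟩, hE⟩ := hω
    obtain ⟨j, hj⟩ := exists_mem_exceed hk hp hc hd h1 (Ck_eq_seqInf hk hc hd ▸ h2) hE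
    exact mem_iUnion.2 ⟨j, ⟨h1, h2⟩, hj⟩
  refine (measure_mono_ae hsub).trans ((measure_iUnion_le _).trans ?_)
  simp_rw [A, h.measure_inter_exceed]
  rw [ENNReal.tsum_mul_left]
  gcongr
  exact h.tsum_measure_exceed_le hb (fun n => (d n).2) hxc k

omit [IsProbabilityMeasure P] in
theorem IsInput.setOf_ae_eq {b : ℝ} {d : ℕ → Icc (-b) b}
    (hd : DenseRange d) (c x : ℝ) {k : ℕ} (hk : 1 ≤ k) :
    ({ω | point Y k ω ≤ x ∧ c < Ck Y W b k ω} : Set Ω)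
      =ᵐ[P] ({ω | point Y k ω ≤ x ∧ c < seqInf Y W (fun n => d n) k ω} : Set Ω) := by
  filter_upwards [h.ae_continuous] with ω hc
  exact propext (by
    change _ ∧ _ ↔ _ ∧ _
    rw [Ck_eq_seqInf hk hc hd])

theorem IsInput.cond_errorEvent_le {b : ℝ} (hb : 0 < b) {c x : ℝ} (hxc : x < c) {k : ℕ}
    (hk : 1 ≤ k) :
    (ProbabilityTheory.cond P {ω | point Y k ω ≤ x ∧ c < Ck Y W b k ω}).real (errorEvent Y W b k)
      ≤ condBound b c x := by
  obtain ⟨d, hd⟩ := exists_denseRange_Icc hb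
  have hae := h.setOf_ae_eq hd c x hk
  have hcond : ProbabilityTheory.cond P {ω | point Y k ω ≤ x ∧ c < Ck Y W b k ω}
      = ProbabilityTheory.cond P {ω | point Y k ω ≤ x ∧ c < seqInf Y W (fun n => d n) k ω} := by
    unfold ProbabilityTheory.cond
    rw [measure_congr hae, Measure.restrict_congr_set hae]
  have hA : MeasurableSet {ω | point Y k ω ≤ x ∧ c < seqInf Y W (fun n => d n) k ω} :=
    measurableSet_point_le_lt_seqInf (fun i _ => h.measurable_Y i)
      (fun i _ => (h.brownian_W i).measurable) _ _ _
  rw [hcond, measureReal_def]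
  refine ENNReal.toReal_le_of_le_ofReal (condBound_nonneg hb.le hxc.le) ?_
  rw [cond_apply hA]
  refine (mul_le_mul_right (h.measure_inter_errorEvent_le hb hd hxc hk) _).trans ?_
  rw [← mul_assoc]
  -- A null conditioning event, as for `k = 1`, is covered because `⊤ * 0 = 0`.
  exact mul_le_of_le_one_left' (ENNReal.inv_mul_le_one _)

theorem IsInput.measureReal_Ck_le {b : ℝ} (hb : 0 < b) {c : ℝ} (hc : c < 0) {k : ℕ}
    (hk : 1 ≤ k) : P.real {ω | Ck Y W b k ω ≤ c} ≤ infBound b c := by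
  obtain ⟨d, hd⟩ := exists_denseRange_Icc hb
  set R : Set Ω := Y 0 ⁻¹' Iio (Real.exp (-c / 2))
  set S : Set Ω := {ω | ∀ n, c / 2 ≤ W 0 (d n) ω}
  have hS' : MeasurableSet {w : ℕ → ℝ → ℝ | ∀ n, c / 2 ≤ w 0 (d n)} := by
    rw [ofPred_forall]
    exact MeasurableSet.iInter fun n => measurableSet_le (by fun_prop) (by fun_prop)
  have hSm : MeasurableSet S := by
    simp only [S]
    rw [ofPred_forall]
    exact MeasurableSet.iInter fun n =>
      measurableSet_le measurable_const ((h.brownian_W 0).measurable _)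
  have hRm : MeasurableSet R := h.measurable_Y 0 measurableSet_Iio
  have hRS : P.real (R ∩ S) = P.real R * P.real S := by
    have := h.indep_Y_W.measure_inter_preimage_eq_mul {y | y 0 < Real.exp (-c / 2)} _
      (measurableSet_lt (by fun_prop) (by fun_prop)) hS'
    simp only [measureReal_def, ← ENNReal.toReal_mul]
    exact congrArg ENNReal.toReal this
  have hR : P.real R = 1 - Real.exp (-Real.exp (-c / 2)) := by
    rw [measureReal_def, ← Measure.map_apply (h.measurable_Y 0) measurableSet_Iio,
      (h.law_Y 0).map_eq, expMeasure_one_Iio (Real.exp_nonneg _), ENNReal.toReal_ofReal]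
    have := Real.exp_le_one_iff.2 (neg_nonpos.2 (Real.exp_nonneg (-c / 2)))
    linarith
  have hS : (2 * Phi (-c / (2 * √b)) - 1) ^ 2 ≤ P.real S := by
    have := (h.brownian_W 0).sq_le_measureReal_forall_le (fun n => (d n : ℝ)) (fun n => (d n).2) hb
      (c := c / 2) (by linarith)
    rwa [show -(c / 2) / √b = -c / (2 * √b) by ring] at this
  have hsub : ({ω | Ck Y W b k ω ≤ c} : Set Ω) ≤ᵐ[P] ((R ∩ S)ᶜ : Set Ω) := by
    filter_upwards [h.ae_continuous, h.ae_pos] with ω hcont hp hω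
    rintro ⟨h1, h2⟩
    refine absurd hω (not_le.2 (lt_Ck hk hcont hd ?_ h2))
    have h3 : Real.log (Y 0 ω) < -c / 2 := (Real.log_lt_iff_lt_exp (hp 0)).2 h1
    simp only [point, Finset.sum_range_one, one_div, Real.log_inv]
    linarith
  have h0 : P.real {ω | Ck Y W b k ω ≤ c} ≤ P.real (R ∩ S)ᶜ :=
    ENNReal.toReal_mono (measure_ne_top _ _) (measure_mono_ae hsub)
  rw [probReal_compl_eq_one_sub (hRm.inter hSm), hRS] at h0
  refine h0.trans ?_
  unfold infBound
  rw [← hR]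
  gcongr

theorem IsInput.measureReal_point_gt_le (x : ℝ) {k : ℕ} (hk : 1 ≤ k) :
    P.real {ω | x < point Y k ω} ≤ pointBound k x := by
  obtain ⟨n, rfl⟩ := Nat.exists_eq_add_of_le' hk
  have hsub : ({ω | x < point Y (n + 1) ω} : Set Ω)
      ≤ᵐ[P] ({ω | ∑ i ∈ Finset.range (n + 1), Y i ω < Real.exp (-x)} : Set Ω) := by
    filter_upwards [h.ae_pos] with ω hp hω
    have hS : 0 < ∑ i ∈ Finset.range (n + 1), Y i ω :=
      Finset.sum_pos (fun i _ => hp i) ⟨0, by simp⟩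
    change x < point Y (n + 1) ω at hω
    rw [point, one_div, Real.log_inv] at hω
    exact (Real.log_lt_iff_lt_exp hS).1 (by linarith)
  have hw := measure_walk_lt_le h.measurable_Y h.law_Y h.indep_Y n (Real.exp_nonneg (-x))
  have h1 := Real.exp_le_one_iff.2 (neg_nonpos.2 (Real.exp_nonneg (-x)))
  refine (ENNReal.toReal_le_of_le_ofReal (mul_nonneg (by positivity) (by linarith))
    ((measure_mono_ae hsub).trans hw)).trans (le_of_eq ?_)
  unfold pointBound
  rw [← Real.exp_nat_mul]
  simp

theorem IsInput.measureReal_errorEvent_le {b : ℝ} (hb : 0 < b) {c x : ℝ} (hxc : x < c)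
    (hc : c < 0) {k : ℕ} (hk : 1 ≤ k) :
    P.real (errorEvent Y W b k) ≤ condBound b c x + infBound b c + pointBound k x := by
  obtain ⟨d, hd⟩ := exists_denseRange_Icc hb
  set A := {ω | point Y k ω ≤ x ∧ c < seqInf Y W (fun n => d n) k ω}
  have hA : P.real (A ∩ errorEvent Y W b k) ≤ condBound b c x :=
    ENNReal.toReal_le_of_le_ofReal (condBound_nonneg hb.le hxc.le)
      ((h.measure_inter_errorEvent_le hb hd hxc hk).trans (mul_le_of_le_one_left' prob_le_one))
  have hsub : (errorEvent Y W b k : Set Ω) ≤ᵐ[P]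
      ((A ∩ errorEvent Y W b k) ∪ {ω | Ck Y W b k ω ≤ c} ∪ {ω | x < point Y k ω} : Set Ω) := by
    filter_upwards [h.ae_continuous] with ω hcont hω
    by_cases h1 : x < point Y k ω
    · exact Or.inr h1
    · by_cases h2 : Ck Y W b k ω ≤ c
      · exact Or.inl (Or.inr h2)
      · rw [Ck_eq_seqInf hk hcont hd, not_le] at h2
        exact Or.inl (Or.inl ⟨⟨not_lt.1 h1, h2⟩, hω⟩)
  have h0 := ENNReal.toReal_mono (measure_ne_top P _) (measure_mono_ae hsub)
  change P.real _ ≤ P.real _ at h0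
  have h1 := measureReal_union_le (μ := P) (A ∩ errorEvent Y W b k ∪ {ω | Ck Y W b k ω ≤ c})
    {ω | x < point Y k ω}
  have h2 := measureReal_union_le (μ := P) (A ∩ errorEvent Y W b k) {ω | Ck Y W b k ω ≤ c}
  have h3 := h.measureReal_Ck_le hb hc hk
  have h4 := h.measureReal_point_gt_le x hk
  linarith

end Bounds

/-! ### Asymptotics in `k` and in `b` -/

theorem tendsto_log_div_two_atTop :
    Tendsto (fun k : ℕ => Real.log k / 2) atTop atTop :=
  (Real.tendsto_log_atTop.comp tendsto_natCast_atTop_atTop).atTop_div_const two_pos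

theorem tendsto_log_div_sub_log : Tendsto (fun u : ℝ => Real.log u / (u - Real.log u))
    atTop (𝓝 0) := by
  have h : Tendsto (fun u : ℝ => Real.log u / u) atTop (𝓝 0) :=
    Real.isLittleO_log_id_atTop.tendsto_div_nhds_zero
  have h2 : Tendsto (fun u : ℝ => (Real.log u / u) / (1 - Real.log u / u)) atTop (𝓝 0) := by
    have := h.div (h.const_sub 1) (by norm_num)
    rwa [zero_div] at this
  refine h2.congr' ?_
  filter_upwards [eventually_gt_atTop 0] with u hu
  rw [show 1 - Real.log u / u = (u - Real.log u) / u by field_simp]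
  exact div_div_div_cancel_right₀ hu.ne' _ _

theorem xSeq_eq (k : ℕ) : xSeq k = -(Real.log k / 2) := by
  unfold xSeq; ring

theorem eventually_xSeq_lt_cSeq : ∀ᶠ k : ℕ in atTop, xSeq k < cSeq k ∧ cSeq k < 0 := by
  have h : ∀ᶠ u : ℝ in atTop, -u < -Real.log (Real.log u) ∧ -Real.log (Real.log u) < 0 := by
    filter_upwards [Real.tendsto_log_atTop.eventually_gt_atTop 1, eventually_gt_atTop 1]
      with u hu hu1
    refine ⟨neg_lt_neg ?_, neg_neg_of_pos (Real.log_pos hu)⟩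
    have h1 := Real.log_le_sub_one_of_pos (show 0 < Real.log u by linarith)
    have h2 := Real.log_le_sub_one_of_pos (show 0 < u by linarith)
    linarith
  filter_upwards [tendsto_log_div_two_atTop.eventually h] with k hk
  rw [xSeq_eq]
  exact hk

/-- With `u = log k / 2` one has `x = -u`, `e^{-c} = log u` and `c - x = u - log log u ≥ u - log u`.
Since `1 - Φ ≤ 1`, the bound is at most a constant times `log u / (u - log u)`. -/
theorem tendsto_condBound_seq {b : ℝ} (hb : 0 < b) :
    Tendsto (fun k : ℕ => condBound b (cSeq k) (xSeq k)) atTop (𝓝 0) := by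
  have hF : Tendsto (fun u : ℝ => 4 * b * Real.exp (b / 2) * (Real.log u / (u - Real.log u)))
      atTop (𝓝 0) := by
    simpa using tendsto_log_div_sub_log.const_mul (4 * b * Real.exp (b / 2))
  have hmain : ∀ᶠ u : ℝ in atTop,
      condBound b (-Real.log (Real.log u)) (-u) ≤
        4 * b * Real.exp (b / 2) * (Real.log u / (u - Real.log u)) := by
    filter_upwards [Real.tendsto_log_atTop.eventually_gt_atTop 1, eventually_gt_atTop 1]
      with u hu hu1
    have h1 := Real.log_le_sub_one_of_pos (show 0 < Real.log u by linarith)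
    have h2 := Real.log_le_sub_one_of_pos (show 0 < u by linarith)
    have hlt : 0 < u - Real.log u := by linarith
    unfold condBound
    rw [neg_neg, Real.exp_log (by linarith)]
    set q := Phi ((-Real.log (Real.log u) - -u - b) / √b)
    have hq1 : 1 - q ≤ 1 := by have := Phi_nonneg ((-Real.log (Real.log u) - -u - b) / √b); linarith
    have hlog : (0 : ℝ) ≤ Real.log u := by linarith
    have hden : u - Real.log u ≤ -Real.log (Real.log u) - -u := by linarith
    calc _ ≤ 4 * Real.log u * (b / (-Real.log (Real.log u) - -u)) * Real.exp (b / 2) * 1 := by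
          have : 0 ≤ b / (-Real.log (Real.log u) - -u) := div_nonneg hb.le (by linarith)
          gcongr
      _ ≤ 4 * Real.log u * (b / (u - Real.log u)) * Real.exp (b / 2) * 1 := by gcongr
      _ = _ := by ring
  refine squeeze_zero' ?_ ?_ (hF.comp tendsto_log_div_two_atTop)
  · filter_upwards [eventually_xSeq_lt_cSeq] with k hk
    exact condBound_nonneg hb.le hk.1.le
  · filter_upwards [tendsto_log_div_two_atTop.eventually hmain] with k hk
    rw [xSeq_eq]
    exact hk

theorem tendsto_neg_cSeq : Tendsto (fun k : ℕ => -cSeq k) atTop atTop := by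
  have := (Real.tendsto_log_atTop.comp Real.tendsto_log_atTop).comp tendsto_log_div_two_atTop
  refine this.congr fun k => ?_
  simp [cSeq]

theorem tendsto_infBound_seq {b : ℝ} (hb : 0 < b) :
    Tendsto (fun k : ℕ => infBound b (cSeq k)) atTop (𝓝 0) := by
  have h1 : Tendsto (fun k : ℕ => Real.exp (-Real.exp (-cSeq k / 2))) atTop (𝓝 0) :=
    Real.tendsto_exp_neg_atTop_nhds_zero.comp
      (Real.tendsto_exp_atTop.comp (tendsto_neg_cSeq.atTop_div_const two_pos))
  have h2 : Tendsto (fun k : ℕ => Phi (-cSeq k / (2 * √b))) atTop (𝓝 1) :=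
    (tendsto_cdf_atTop _).comp (tendsto_neg_cSeq.atTop_div_const (by positivity))
  have h3 := ((h1.const_sub 1).mul (((h2.const_mul 2).sub_const 1).pow 2)).const_sub 1
  have h4 : (1 : ℝ) - (1 - 0) * (2 * 1 - 1) ^ 2 = 0 := by norm_num
  rw [h4] at h3
  exact h3

/-- The square of the exponential is `(n+1)^n`, and `a^n / n! ≤ e^a` at `a = n + 1` absorbs one of
the two factorials; the other one drives the limit. -/
theorem exp_neg_mul_xSeq_div_factorial_le (n : ℕ) :
    Real.exp (-(n : ℝ) * xSeq (n + 1)) / n ! ≤ √(Real.exp 1 * (Real.exp 1 ^ n / n !)) := by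
  refine Real.le_sqrt_of_sq_le ?_
  have h1 : Real.exp (-(n : ℝ) * xSeq (n + 1)) ^ 2 = ((n : ℝ) + 1) ^ n := by
    rw [← Real.exp_nat_mul, xSeq, ← Real.rpow_natCast, Real.rpow_def_of_pos (by positivity)]
    congr 1
    push_cast
    ring
  have h2 : ((n : ℝ) + 1) ^ n / n ! ≤ Real.exp 1 ^ (n + 1) := by
    rw [← Real.exp_nat_mul, mul_one]
    push_cast
    exact Real.pow_div_factorial_le_exp _ (by positivity) n
  rw [div_pow, h1, sq (n ! : ℝ), ← div_div, ← mul_div_assoc, ← pow_succ']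
  gcongr

theorem tendsto_pointBound_seq : Tendsto (fun k : ℕ => pointBound k (xSeq k)) atTop (𝓝 0) := by
  rw [← tendsto_add_atTop_iff_nat 1]
  have h : Tendsto (fun n : ℕ => √(Real.exp 1 * (Real.exp 1 ^ n / n !))) atTop (𝓝 0) := by
    have := ((FloorSemiring.tendsto_pow_div_factorial_atTop (Real.exp 1)).const_mul
      (Real.exp 1)).sqrt
    simpa using this
  have h0 : ∀ n : ℕ, 0 ≤ 1 - Real.exp (-Real.exp (-xSeq (n + 1))) ∧
      1 - Real.exp (-Real.exp (-xSeq (n + 1))) ≤ 1 := fun n => by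
    have h1 := Real.exp_le_one_iff.2 (neg_nonpos.2 (Real.exp_nonneg (-xSeq (n + 1))))
    have h2 := Real.exp_nonneg (-Real.exp (-xSeq (n + 1)))
    constructor <;> linarith
  refine squeeze_zero (fun n => mul_nonneg (by positivity) (h0 n).1) (fun n => ?_) h
  unfold pointBound
  refine (mul_le_of_le_one_right (by positivity) (h0 n).2).trans ?_
  simpa using exp_neg_mul_xSeq_div_factorial_le n

theorem tendsto_condBound_div (c x : ℝ) :
    Tendsto (fun β : ℝ => condBound β c x / (β * Real.exp (β / 2))) atTop
      (𝓝 (4 * Real.exp (-c) / (c - x))) := by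
  -- The argument equals `(c - x)/√β - √β`, so `Φ` tends to `0`.
  have harg : Tendsto (fun β : ℝ => (c - x - β) / √β) atTop atBot := by
    have h1 : Tendsto (fun β : ℝ => (c - x) / √β) atTop (𝓝 0) :=
      tendsto_const_nhds.div_atTop Real.tendsto_sqrt_atTop
    have h2 := h1.add_atBot (tendsto_neg_atTop_atBot.comp Real.tendsto_sqrt_atTop)
    refine h2.congr' ?_
    filter_upwards [eventually_gt_atTop 0] with β hβ
    simp only [Function.comp_apply]
    rw [sub_div _ β, Real.div_sqrt, sub_eq_add_neg _ √β]
  have h3 := (((tendsto_cdf_atBot (gaussianReal 0 1)).comp harg).const_sub 1).const_mul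
    (4 * Real.exp (-c) / (c - x))
  rw [sub_zero, mul_one] at h3
  refine h3.congr' ?_
  filter_upwards [eventually_gt_atTop 0] with β hβ
  simp only [condBound, Phi, Function.comp_apply]
  field_simp

end BrownResnick

theorem mainTheorem9 {Ω : Type*} [MeasurableSpace Ω] (P : MeasureTheory.Measure Ω)
    [MeasureTheory.IsProbabilityMeasure P] (Y : ℕ → Ω → ℝ) (W : ℕ → ℝ → Ω → ℝ)
    (hYW : BrownResnick.IsInput Y W P) (b : ℝ) (hb : 0 < b) :
    -- the explicit bounds
    (∀ k : ℕ, 1 ≤ k → ∀ c x : ℝ, x < c → c < 0 →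
      (ProbabilityTheory.cond P
          {ω | BrownResnick.point Y k ω ≤ x ∧ c < BrownResnick.Ck Y W b k ω}).real
          (BrownResnick.errorEvent Y W b k) ≤ BrownResnick.condBound b c x ∧
      P.real {ω | BrownResnick.Ck Y W b k ω ≤ c} ≤ BrownResnick.infBound b c ∧
      P.real {ω | x < BrownResnick.point Y k ω} ≤ BrownResnick.pointBound k x ∧
      P.real (BrownResnick.errorEvent Y W b k) ≤
        BrownResnick.condBound b c x + BrownResnick.infBound b c + BrownResnick.pointBound k x) ∧
    -- a choice of `c(k)` and `x(k)` for which all three bounds tend to zero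
    (∀ᶠ k : ℕ in Filter.atTop,
      BrownResnick.xSeq k < BrownResnick.cSeq k ∧ BrownResnick.cSeq k < 0) ∧
    Filter.Tendsto (fun k : ℕ =>
      BrownResnick.condBound b (BrownResnick.cSeq k) (BrownResnick.xSeq k))
      Filter.atTop (nhds 0) ∧
    Filter.Tendsto (fun k : ℕ => BrownResnick.infBound b (BrownResnick.cSeq k))
      Filter.atTop (nhds 0) ∧
    Filter.Tendsto (fun k : ℕ => BrownResnick.pointBound k (BrownResnick.xSeq k))
      Filter.atTop (nhds 0) ∧
    Filter.Tendsto (fun k : ℕ => P.real (BrownResnick.errorEvent Y W b k))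
      Filter.atTop (nhds 0) ∧
    -- growth of the conditional bound in the length of the interval
    (∀ c x : ℝ, x < c → c < 0 →
      Filter.Tendsto (fun β : ℝ => BrownResnick.condBound β c x / (β * Real.exp (β / 2)))
        Filter.atTop (nhds (4 * Real.exp (-c) / (c - x)))) := by
  refine ⟨fun k hk c x hxc hc => ⟨hYW.cond_errorEvent_le hb hxc hk, hYW.measureReal_Ck_le hb hc hk,
      hYW.measureReal_point_gt_le x hk, hYW.measureReal_errorEvent_le hb hxc hc hk⟩,
    BrownResnick.eventually_xSeq_lt_cSeq, BrownResnick.tendsto_condBound_seq hb,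
    BrownResnick.tendsto_infBound_seq hb, BrownResnick.tendsto_pointBound_seq, ?_,
    fun c x _ _ => BrownResnick.tendsto_condBound_div c x⟩
  have hsum := ((BrownResnick.tendsto_condBound_seq hb).add
    (BrownResnick.tendsto_infBound_seq hb)).add BrownResnick.tendsto_pointBound_seq
  rw [add_zero, add_zero] at hsum
  refine squeeze_zero' (Eventually.of_forall fun k => measureReal_nonneg) ?_ hsum
  filter_upwards [BrownResnick.eventually_xSeq_lt_cSeq, eventually_ge_atTop 1] with k hk hk1
  exact hYW.measureReal_errorEvent_le hb hk.1 hk.2 hk1
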